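/- Let $(X,d)$ be a complete, not necessarily proper, $\mathrm{CAT}(0)$ space, with visual boundary $\partial_\infty X$ (asymptotic classes of geodesic rays). Equip $X\cup\partial_\infty X$ with the cone topology: $X$ carries its metric topology and is open, and a point $[r]\in\partial_\infty X$ has the basic neighbourhoods consisting, for $t,\epsilon>0$, of all $z\in X\cup\partial_\infty X$ such that the geodesic (possibly a ray) $c$ from $r(0)$ to $z$ has length $>t$ and satisfies $d(c(t),r(t))<\epsilon$. Definitions. For $p\in X$ and $\varepsilon,R>0$, a geodesic quadrilateral $xyy'x'$ (with nondegenerate sides) is a *$(p,\varepsilon,R)$-quadrilateral* if $p\in xy$, the union of the three sides $yy'$, $y'x'$, $x'x$ is at distance $>R$ from $p$, and the sum of its four Alexandrov angles is $>2\pi-\varepsilon$. Points $\xi,\eta\in\partial_\infty X$ are *far* if for some $\varepsilon,R>0$ there are neighbourhoods $U,V$ of $\xi,\eta$ in $X\cup\partial_\infty X$ and a closed metric ball $P\subset X$ such that for all $u\in U$, $v\in V$, at least one of which is in $X$, there is a point $p$ in the intersection of $P$ with the geodesic $uv$ (possibly a ray) that does not lie in any segment of $uv$ that is a side of a $(p,\varepsilon,R)$-quadrilateral.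 The *translation length* of an isometry $h$ of $X$ is $|h|=\inf_{x\in X}d(x,h(x))$; $h$ is *parabolic* if this infimum is not attained. A point $\xi\in\partial_\infty X$ is the *positive* (resp. *negative*) *limit point* of $h$ if for some (equivalently, any) $x\in X$ we have $h^n(x)\to\xi$ as $n\to\infty$ (resp. $n\to-\infty$). A parabolic isometry $h$ with $|h|=0$ is *vile* if there is no $\xi\in\partial_\infty X$ that is both its positive and its negative limit point. Proposition. Let $f,g$ be isometries of $X$ that have positive limit points $\xi_f^+,\xi_g^+$ that are far and negative limit points $\xi_f^-,\xi_g^-$ that are far. Then for any neighbourhoods $U_0,V_0$ of $\xi_f^+,\xi_g^+$ in $X\cup\partial_\infty X$, for all sufficiently large $n$, the isometry $h_n=f^ng^{-n}$ is vile, or it has positive translation length and has a positive limit point in $U_0$ and a negative limit point in $V_0$ that are far. -/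

import Mathlib

open Filter Topology

noncomputable section

namespace CATZero

/-- `c`, restricted to `[0, l]`, is a geodesic (an isometric embedding of `[0, l]`) from `x` to
`y`; the values of `c` outside `[0, l]` are irrelevant. -/
structure IsGeodesicPath {X : Type*} [MetricSpace X] (c : ℝ → X) (l : ℝ) (x y : X) : Prop where
  nonneg : 0 ≤ l
  source : c 0 = x
  target : c l = y
  isom : ∀ s ∈ Set.Icc 0 l, ∀ t ∈ Set.Icc 0 l, dist (c s) (c t) = |s - t|

/-- The geodesic segment `xy`, as a subset of `X`. (Formally the set of points lying on some
geodesic from `x` to `y`; in a `CAT(0)` space that geodesic is unique.) -/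
def seg {X : Type*} [MetricSpace X] (x y : X) : Set X :=
  {p | ∃ c l, IsGeodesicPath c l x y ∧ ∃ t ∈ Set.Icc 0 l, c t = p}

/-- `CAT(0)` spaces: geodesic metric spaces in which every geodesic triangle is at least as thin
as its comparison triangle in the Euclidean plane. Two sides of a triangle share a vertex, here
`x`; `p` and `q` are points on the sides `xy` and `xz`, and `p'`, `q'` are their comparison points
on the sides `x'y'`, `x'z'` of the comparison triangle `x'y'z'`. -/
class CAT0Space (X : Type*) [MetricSpace X] : Prop where
  exists_geodesic : ∀ x y : X, ∃ c l, IsGeodesicPath c l x y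
  comparison : ∀ x y z p q : X, p ∈ seg x y → q ∈ seg x z →
    ∀ x' y' z' p' q' : EuclideanSpace ℝ (Fin 2),
      dist x' y' = dist x y → dist x' z' = dist x z → dist y' z' = dist y z →
      dist x' p' = dist x p → dist p' y' = dist p y →
      dist x' q' = dist x q → dist q' z' = dist q z →
      dist p q ≤ dist p' q'

/-- The angle at the vertex corresponding to `p` of the Euclidean comparison triangle of
`p, x, y` (for `x ≠ p` and `y ≠ p`), by the law of cosines. -/
def comparisonAngle {X : Type*} [MetricSpace X] (p x y : X) : ℝ :=
  Real.arccos ((dist p x ^ 2 + dist p y ^ 2 - dist x y ^ 2) / (2 * dist p x * dist p y))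

/-- The Alexandrov angle at `p` between the geodesic segments `px` and `py`, for `x ≠ p` and
`y ≠ p`: the upper limit of the comparison angles at `p` of `p, u, v`, where `u ≠ p` tends to `p`
along `px` and, independently, `v ≠ p` tends to `p` along `py`. -/
def alexandrovAngle {X : Type*} [MetricSpace X] (p x y : X) : ℝ :=
  limsup (fun w : X × X => comparisonAngle p w.1 w.2)
    (𝓝[seg p x \ {p}] p ×ˢ 𝓝[seg p y \ {p}] p)

/-- Geodesic rays `[0, ∞) → X`; the values at negative reals are irrelevant. -/
def Ray (X : Type*) [MetricSpace X] : Type _ :=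
  {r : ℝ → X // ∀ s t : ℝ, 0 ≤ s → 0 ≤ t → dist (r s) (r t) = |s - t|}

/-- The equivalence relation of being asymptotic on geodesic rays. -/
def asymptoticSetoid (X : Type*) [MetricSpace X] : Setoid (Ray X) where
  r a b := ∃ d : ℝ, ∀ t : ℝ, 0 ≤ t → dist (a.1 t) (b.1 t) ≤ d
  iseqv :=
    { refl := fun a => ⟨0, fun t _ => by simp⟩
      symm := fun {a b} ⟨d, h⟩ => ⟨d, fun t ht => by rw [dist_comm]; exact h t ht⟩
      trans := fun {a b c} ⟨d, h⟩ ⟨e, k⟩ => ⟨d + e, fun t ht =>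
        (dist_triangle _ (b.1 t) _).trans (add_le_add (h t ht) (k t ht))⟩ }

/-- The visual boundary `∂X`. -/
def Boundary (X : Type*) [MetricSpace X] : Type _ := Quotient (asymptoticSetoid X)

/-- The class `[r]` of a geodesic ray in the visual boundary. -/
def Ray.endpoint {X : Type*} [MetricSpace X] (r : Ray X) : Boundary X :=
  Quotient.mk (asymptoticSetoid X) r

/-- The disjoint union `X ∪ ∂X`. -/
inductive Bordification (X : Type*) [MetricSpace X] : Type _
  | point (x : X) : Bordification X
  | ideal (ξ : Boundary X) : Bordification X

/-- The basic neighbourhood of `[r]` based at `r 0`: the set of those `z` in `X ∪ ∂X` such that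
the geodesic (possibly a ray) `c` from `r 0` to `z` has length `> t` and satisfies
`dist (c t) (r t) < ε`. -/
def basicNhd {X : Type*} [MetricSpace X] (r : Ray X) (t ε : ℝ) : Set (Bordification X) :=
  {z | match z with
    | .point y => ∃ c l, IsGeodesicPath c l (r.1 0) y ∧ t < l ∧ dist (c t) (r.1 t) < ε
    | .ideal ξ => ∃ c : Ray X, c.1 0 = r.1 0 ∧ c.endpoint = ξ ∧ dist (c.1 t) (r.1 t) < ε}

/-- The cone topology on `X ∪ ∂X`, generated by the open subsets of `X` and by the basic
neighbourhoods of the boundary points. -/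
instance coneTopology (X : Type*) [MetricSpace X] : TopologicalSpace (Bordification X) :=
  TopologicalSpace.generateFrom
    ({S | ∃ O : Set X, IsOpen O ∧ S = Bordification.point '' O} ∪
      {S | ∃ (r : Ray X) (t ε : ℝ), 0 < t ∧ 0 < ε ∧ S = basicNhd r t ε})

/-- The geodesic ray from `x` to the boundary point `ξ`, as a subset of `X`. -/
def raySet {X : Type*} [MetricSpace X] (x : X) (ξ : Boundary X) : Set X :=
  {p | ∃ r : Ray X, r.1 0 = x ∧ r.endpoint = ξ ∧ ∃ t : ℝ, 0 ≤ t ∧ r.1 t = p}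

/-- The geodesic `uv` (possibly a ray), as a subset of `X`, for `u, v` in `X ∪ ∂X` at least one of
which is in `X`. The value for two boundary points is not used. -/
def geod {X : Type*} [MetricSpace X] : Bordification X → Bordification X → Set X
  | .point x, .point y => seg x y
  | .point x, .ideal ξ => raySet x ξ
  | .ideal ξ, .point x => raySet x ξ
  | .ideal _, .ideal _ => ∅

/-- The geodesic quadrilateral with consecutive vertices `x, y, y', x'` is a
`(p, ε, R)`-quadrilateral. Its sides are nondegenerate, so that the Alexandrov angles at its
vertices make sense; `x ≠ y` follows from the other conditions when `0 < R`. -/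
structure IsQuadrilateral {X : Type*} [MetricSpace X] (p : X) (ε R : ℝ) (x y y' x' : X) :
    Prop where
  ne_xy : x ≠ y
  ne_yy' : y ≠ y'
  ne_y'x' : y' ≠ x'
  ne_x'x : x' ≠ x
  mem : p ∈ seg x y
  dist_gt : ∀ q ∈ seg y y' ∪ seg y' x' ∪ seg x' x, R < dist p q
  angle_sum : 2 * Real.pi - ε < alexandrovAngle x x' y + alexandrovAngle y x y' +
    alexandrovAngle y' y x' + alexandrovAngle x' y' x

/-- The boundary points `ξ, η` are `(ε, R)`-far. -/
def IsFarWith {X : Type*} [MetricSpace X] (ε R : ℝ) (ξ η : Boundary X) : Prop :=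
  ∃ U ∈ 𝓝 (Bordification.ideal ξ), ∃ V ∈ 𝓝 (Bordification.ideal η), ∃ (o : X) (ρ : ℝ),
    ∀ u ∈ U, ∀ v ∈ V,
      (u ∈ Set.range Bordification.point ∨ v ∈ Set.range Bordification.point) →
      ∃ p ∈ geod u v ∩ Metric.closedBall o ρ,
        ¬ ∃ x y y' x' : X, seg x y ⊆ geod u v ∧ IsQuadrilateral p ε R x y y' x'

/-- The boundary points `ξ, η` are far. -/
def IsFar {X : Type*} [MetricSpace X] (ξ η : Boundary X) : Prop :=
  ∃ ε R : ℝ, 0 < ε ∧ 0 < R ∧ IsFarWith ε R ξ η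

/-- The translation length of an isometry. -/
def translationLength {X : Type*} [MetricSpace X] (g : X ≃ᵢ X) : ℝ := ⨅ x : X, dist x (g x)

/-- `ξ` is the positive limit point of `g`. -/
def IsPosLimit {X : Type*} [MetricSpace X] (g : X ≃ᵢ X) (ξ : Boundary X) : Prop :=
  ∃ x : X, Tendsto (fun n : ℕ => Bordification.point ((g ^ n) x)) atTop
    (𝓝 (Bordification.ideal ξ))

/-- `ξ` is the negative limit point of `g`. -/
def IsNegLimit {X : Type*} [MetricSpace X] (g : X ≃ᵢ X) (ξ : Boundary X) : Prop :=
  ∃ x : X, Tendsto (fun n : ℕ => Bordification.point ((g ^ (-(n : ℤ))) x)) atTop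
    (𝓝 (Bordification.ideal ξ))

/-- `g` is parabolic: the infimum defining its translation length is not attained. -/
def IsParabolic {X : Type*} [MetricSpace X] (g : X ≃ᵢ X) : Prop :=
  ¬ ∃ x : X, dist x (g x) = translationLength g

/-- `g` is vile: parabolic, of translation length zero, and no boundary point is both its
positive and its negative limit point. -/
def IsVile {X : Type*} [MetricSpace X] (g : X ≃ᵢ X) : Prop :=
  IsParabolic g ∧ translationLength g = 0 ∧ ¬ ∃ ξ : Boundary X, IsPosLimit g ξ ∧ IsNegLimit g ξ

end CATZero

end

open CATZero

/-! The vile alternative never occurs: a ping-pong argument gives the second one for all large `n`.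
Put `F = f ^ n`, `G = g ^ n`, `h = F * G⁻¹`. Farness is used only through `IsFar.exists_nhds`:
geodesics between neighbourhoods `U`, `V` of the positive limit points, or `U'`, `V'` of the
negative ones, pass within `ρ` of a basepoint `x`, and farness persists for boundary points in `U`,
`V`. By `eventually_shadow_subset`, for large `n` the shadows of balls about `F x`, `G x`, `F⁻¹ x`,
`G⁻¹ x` lie in `U`, `V`, `U'`, `V'`; this is `PingPong`.

If `y` is in `U`, the geodesic from `y` to `G x` passes near `x`; applying `G⁻¹` puts `G⁻¹ y` in
`V'`. Likewise `F` maps points of `V'` into `U`. So the forward orbit of `x` under `h` stays in `U`,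
the backward orbit in `V`, and each step moves away from `x` by a definite amount, whence positive
translation length. A geodesic from `h ^ k x` to `h ^ (-i) x` passes near `x`; translated by `h ^
i`, it goes from `x` to `h ^ (i + k) x` and passes near `h ^ i x`. By CAT(0) comparison and
completeness (`exists_ray_of_near`) such an orbit converges to a boundary point. -/

noncomputable section

namespace CATZero

variable {X : Type*} [MetricSpace X]

/-! ### Geodesics and CAT(0) comparison -/

/-- `p` lies metrically between `x` and `y`. -/
def Btw (x p y : X) : Prop := dist x p + dist p y = dist x y

theorem Btw.symm {x p y : X} (h : Btw x p y) : Btw y p x := by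
  unfold Btw at *
  rw [dist_comm y p, dist_comm p x, dist_comm y x]
  linarith

theorem Btw.le {x p y : X} (h : Btw x p y) : dist x p ≤ dist x y := by
  unfold Btw at h
  linarith [dist_nonneg (x := p) (y := y)]

theorem Btw.trans_left {x p q y : X} (h : Btw x p q) (k : Btw x q y) : Btw x p y := by
  unfold Btw at *
  linarith [dist_triangle x p y, dist_triangle p q y]

theorem Btw.trans_right {x p q y : X} (h : Btw x p y) (k : Btw p q y) : Btw x q y := by
  unfold Btw at *
  linarith [dist_triangle x q y, dist_triangle x p q]

theorem IsGeodesicPath.length {c : ℝ → X} {l : ℝ} {x y : X} (h : IsGeodesicPath c l x y) :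
    l = dist x y := by
  have := h.isom 0 ⟨le_rfl, h.nonneg⟩ l ⟨h.nonneg, le_rfl⟩
  rw [h.source, h.target, zero_sub, abs_neg, abs_of_nonneg h.nonneg] at this
  exact this.symm

theorem IsGeodesicPath.dist_source {c : ℝ → X} {l : ℝ} {x y : X} (h : IsGeodesicPath c l x y)
    {t : ℝ} (ht : t ∈ Set.Icc 0 l) : dist x (c t) = t := by
  have := h.isom 0 ⟨le_rfl, h.nonneg⟩ t ht
  rw [h.source, zero_sub, abs_neg, abs_of_nonneg ht.1] at this
  exact this

theorem IsGeodesicPath.btw {c : ℝ → X} {l : ℝ} {x y : X} (h : IsGeodesicPath c l x y)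
    {t : ℝ} (ht : t ∈ Set.Icc 0 l) : Btw x (c t) y := by
  have h1 := h.isom t ht l ⟨h.nonneg, le_rfl⟩
  rw [h.target, abs_of_nonpos (by linarith [ht.2])] at h1
  unfold Btw
  rw [h.dist_source ht, h1, ← h.length]
  ring

/-- Concatenation of two geodesics through a point metrically between their endpoints. -/
theorem Btw.exists_path [CAT0Space X] {x p y : X} (h : Btw x p y) :
    ∃ c, IsGeodesicPath c (dist x y) x y ∧ c (dist x p) = p := by
  obtain ⟨c₁, l₁, h₁⟩ := CAT0Space.exists_geodesic x p
  obtain ⟨c₂, l₂, h₂⟩ := CAT0Space.exists_geodesic p y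
  obtain rfl := h₁.length
  obtain rfl := h₂.length
  unfold Btw at h
  have hn := dist_nonneg (x := x) (y := p)
  have hn' := dist_nonneg (x := p) (y := y)
  -- The triangle inequality through `p` gives one bound; the other holds because the path from `x`
  -- to `y` via both points is no shorter than `dist x y`.
  have key : ∀ s ∈ Set.Icc 0 (dist x p), ∀ t ∈ Set.Icc 0 (dist p y),
      dist (c₁ s) (c₂ t) = dist x p + t - s := by
    intro s hs t ht
    have a1 := h₁.dist_source hs
    have a2 := h₁.btw hs
    have b1 := h₂.dist_source ht
    have b2 := h₂.btw ht
    unfold Btw at a2 b2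
    have u := dist_triangle (c₁ s) p (c₂ t)
    have v := dist_triangle4 x (c₁ s) (c₂ t) y
    linarith
  refine ⟨fun s => if s ≤ dist x p then c₁ s else c₂ (s - dist x p), ⟨dist_nonneg, ?_, ?_, ?_⟩, ?_⟩
  · simp [hn, h₁.source]
  · by_cases hy : dist p y = 0
    · have : p = y := dist_eq_zero.1 hy
      subst this
      simp [h₁.target]
    · have : 0 < dist p y := lt_of_le_of_ne hn' (Ne.symm hy)
      have hnot : ¬ dist x y ≤ dist x p := by linarith
      simp only [hnot, if_false]
      rw [← h, add_sub_cancel_left, h₂.target]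
  · intro s hs t ht
    by_cases h1 : s ≤ dist x p <;> by_cases h2 : t ≤ dist x p <;> simp only [h1, h2, if_true, if_false]
    · exact h₁.isom s ⟨hs.1, h1⟩ t ⟨ht.1, h2⟩
    · push Not at h2
      rw [key s ⟨hs.1, h1⟩ _ ⟨by linarith, by linarith [ht.2]⟩, abs_of_nonpos (by linarith)]
      ring
    · push Not at h1
      rw [dist_comm, key t ⟨ht.1, h2⟩ _ ⟨by linarith, by linarith [hs.2]⟩,
        abs_of_nonneg (by linarith)]
      ring
    · push Not at h1 h2
      rw [h₂.isom _ ⟨by linarith, by linarith [hs.2]⟩ _ ⟨by linarith, by linarith [ht.2]⟩]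
      congr 1
      ring
  · simp [h₁.target]

theorem mem_seg_iff [CAT0Space X] {x p y : X} : p ∈ seg x y ↔ Btw x p y := by
  constructor
  · rintro ⟨c, l, hc, t, ht, rfl⟩
    exact hc.btw ht
  · intro h
    obtain ⟨c, hc, hp⟩ := h.exists_path
    exact ⟨c, _, hc, _, ⟨dist_nonneg, h.le⟩, hp⟩

theorem exists_btw [CAT0Space X] (x y : X) {t : ℝ} (h0 : 0 ≤ t) (ht : t ≤ dist x y) :
    ∃ p, dist x p = t ∧ Btw x p y := by
  obtain ⟨c, l, hc⟩ := CAT0Space.exists_geodesic x y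
  have hl := hc.length
  have : t ∈ Set.Icc 0 l := ⟨h0, by rwa [hl]⟩
  exact ⟨c t, hc.dist_source this, hc.btw this⟩

/-- Existence of Euclidean comparison triangles with a vertex at the origin. -/
theorem exists_comparison_vectors {a b e : ℝ} (ha : 0 < a) (hb : 0 < b) (h1 : e ≤ a + b)
    (h2 : a ≤ b + e) (h3 : b ≤ a + e) :
    ∃ u v : EuclideanSpace ℝ (Fin 2), ‖u‖ = a ∧ ‖v‖ = b ∧ ‖u - v‖ = e := by
  have he : 0 ≤ e := by linarith
  -- The cosine of the angle between the two vectors.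
  set k := (a ^ 2 + b ^ 2 - e ^ 2) / (2 * a * b) with hk
  have hk' : k * (2 * a * b) = a ^ 2 + b ^ 2 - e ^ 2 := by
    rw [hk]
    field_simp
  have hab : 0 < 2 * a * b := by positivity
  have hk1 : k ≤ 1 := by
    rw [hk, div_le_one hab]
    nlinarith [mul_nonneg (by linarith : 0 ≤ e + (a - b)) (by linarith : 0 ≤ e - (a - b))]
  have hk2 : -1 ≤ k := by
    rw [hk, le_div_iff₀ hab]
    nlinarith [mul_nonneg (by linarith : 0 ≤ a + b - e) (by linarith : 0 ≤ a + b + e)]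
  have hs : √(1 - k ^ 2) ^ 2 = 1 - k ^ 2 := Real.sq_sqrt (by nlinarith)
  refine ⟨!₂[a, 0], !₂[b * k, b * √(1 - k ^ 2)], ?_, ?_, ?_⟩
  · rw [EuclideanSpace.norm_eq]
    simp [Fin.sum_univ_two, Real.sqrt_sq ha.le]
  · rw [EuclideanSpace.norm_eq, Real.sqrt_eq_iff_eq_sq (by positivity) hb.le]
    simp only [Real.norm_eq_abs, sq_abs, Fin.sum_univ_two, Matrix.cons_val_zero,
      Matrix.cons_val_one]
    rw [mul_pow, mul_pow, hs]
    ring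
  · rw [EuclideanSpace.norm_eq, Real.sqrt_eq_iff_eq_sq (by positivity) he]
    simp only [Real.norm_eq_abs, sq_abs, Fin.sum_univ_two, PiLp.sub_apply,
      Matrix.cons_val_zero, Matrix.cons_val_one]
    rw [zero_sub, neg_sq, mul_pow, hs]
    linarith

/-- Busemann convexity for two geodesics with a common starting point. -/
theorem dist_le_mul_of_btw [CAT0Space X] {x y z p q : X} {k : ℝ} (hp : Btw x p y) (hq : Btw x q z)
    (h0 : 0 ≤ k) (h1 : k ≤ 1) (hpk : dist x p = k * dist x y) (hqk : dist x q = k * dist x z) :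
    dist p q ≤ k * dist y z := by
  rcases eq_or_ne x y with rfl | hxy
  · obtain rfl : x = p := by simpa using hpk
    exact hqk.le
  rcases eq_or_ne x z with rfl | hxz
  · obtain rfl : x = q := by simpa using hqk
    rw [dist_comm p, dist_comm y, hpk]
  obtain ⟨u, v, hu, hv, huv⟩ := exists_comparison_vectors (dist_pos.2 hxy) (dist_pos.2 hxz)
    (by rw [dist_comm x y]; exact dist_triangle y x z)
    (by rw [dist_comm y z]; exact dist_triangle x z y) (dist_triangle x y z)
  unfold Btw at hp hq
  have key : ∀ w : EuclideanSpace ℝ (Fin 2), dist (k • w) w = (1 - k) * ‖w‖ := fun w => by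
    rw [dist_eq_norm, ← norm_neg, show -(k • w - w) = (1 - k) • w by rw [sub_smul, one_smul]; abel,
      norm_smul, Real.norm_of_nonneg (by linarith)]
  have := CAT0Space.comparison x y z p q (mem_seg_iff.2 hp) (mem_seg_iff.2 hq) 0 u v (k • u) (k • v)
    (by rw [dist_zero_left, hu]) (by rw [dist_zero_left, hv]) (by rw [dist_eq_norm, huv])
    (by rw [dist_zero_left, norm_smul, hu, hpk, Real.norm_of_nonneg h0])
    (by rw [key, hu]; linarith)
    (by rw [dist_zero_left, norm_smul, hv, hqk, Real.norm_of_nonneg h0])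
    (by rw [key, hv]; linarith)
  rwa [dist_eq_norm, ← smul_sub, norm_smul, huv, Real.norm_of_nonneg h0] at this

/-- A point of the geodesic `xy` is close to the geodesic `xz` if `y` is close to `z`. -/
theorem Btw.exists_near [CAT0Space X] {x p y : X} (h : Btw x p y) (z : X) :
    ∃ q, Btw x q z ∧ dist p q ≤ dist y z := by
  rcases eq_or_ne x y with rfl | hxy
  · obtain rfl : x = p := by
      have := h.le
      rw [dist_self] at this
      exact dist_le_zero.1 this
    exact ⟨x, by simp [Btw], by simp⟩
  have hpos := dist_pos.2 hxy
  have h0 : 0 ≤ dist x p / dist x y := by positivity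
  have h1 : dist x p / dist x y ≤ 1 := (div_le_one hpos).2 h.le
  obtain ⟨q, hq, hq'⟩ := exists_btw x z (mul_nonneg h0 (dist_nonneg (x := x) (y := z)))
    (by nlinarith [dist_nonneg (x := x) (y := z)])
  refine ⟨q, hq', (dist_le_mul_of_btw h hq' h0 h1 (by field_simp) hq).trans ?_⟩
  exact mul_le_of_le_one_left dist_nonneg h1

/-- Two geodesics that start at `x` and have nearby endpoints stay close to each other. -/
theorem Btw.dist_mul_le [CAT0Space X] {x p q a b : X} (hp : Btw x p a) (hq : Btw x q b)
    (h : dist x p = dist x q) : dist p q * dist x a ≤ 2 * dist x p * dist a b := by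
  rcases eq_or_ne x a with rfl | hxa
  · rw [dist_self, mul_zero]
    positivity
  have hpos := dist_pos.2 hxa
  set k := dist x p / dist x a with hk
  have hkp : dist x p = k * dist x a := by
    rw [hk]
    field_simp
  have h0 : 0 ≤ k := by positivity
  have h1 : k ≤ 1 := (div_le_one hpos).2 hp.le
  have hb := dist_nonneg (x := x) (y := b)
  have hab : |dist x a - dist x b| ≤ dist a b := by
    rw [abs_le]
    constructor <;> linarith [dist_triangle x a b, dist_triangle x b a, dist_comm a b]
  -- `q'` divides `xb` in the ratio in which `p` divides `xa`. It is built from `q`, towards `x` or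
  -- towards `b`, because uniqueness of geodesics is not yet available: it follows from this
  -- estimate.
  obtain ⟨q', hq1, hq2, hq3⟩ : ∃ q', Btw x q' b ∧ dist x q' = k * dist x b ∧
      dist q' q ≤ k * dist a b := by
    rcases le_total (k * dist x b) (dist x q) with hle | hle
    · obtain ⟨q', h2, h3⟩ := exists_btw x q (mul_nonneg h0 hb) hle
      refine ⟨q', h3.trans_left hq, h2, ?_⟩
      unfold Btw at h3
      nlinarith [(abs_le.1 hab).2]
    · obtain ⟨q', h2, h3⟩ := exists_btw q b (t := k * dist x b - dist x q) (by linarith)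
        (by unfold Btw at hq; nlinarith)
      refine ⟨q', hq.trans_right h3, ?_, ?_⟩
      · have := hq.trans_right h3
        unfold Btw at *
        linarith
      · rw [dist_comm, h2]
        nlinarith [(abs_le.1 hab).1]
  have := dist_le_mul_of_btw hp hq1 h0 h1 hkp hq2
  have hpq : dist p q ≤ 2 * (k * dist a b) := by linarith [dist_triangle p q' q]
  calc dist p q * dist x a ≤ 2 * (k * dist a b) * dist x a := by gcongr
    _ = 2 * dist x p * dist a b := by rw [hkp]; ring

theorem Btw.unique [CAT0Space X] {x p q y : X} (hp : Btw x p y) (hq : Btw x q y)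
    (h : dist x p = dist x q) : p = q := by
  rcases eq_or_ne x y with rfl | hxy
  · have h1 := hp.le
    rw [dist_self] at h1
    have h2 := h1
    rw [h] at h2
    rw [← dist_le_zero.1 h1, ← dist_le_zero.1 h2]
  have := hp.dist_mul_le hq h
  rw [dist_self, mul_zero] at this
  have hpos := dist_pos.2 hxy
  exact dist_le_zero.1 (nonpos_of_mul_nonpos_left this hpos)

/-! ### Rays as limits of geodesics, and asymptotic rays -/

theorem Ray.dist_source (r : Ray X) {t : ℝ} (ht : 0 ≤ t) : dist (r.1 0) (r.1 t) = t := by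
  rw [r.2 0 t le_rfl ht, zero_sub, abs_neg, abs_of_nonneg ht]

theorem Ray.btw (r : Ray X) {s t : ℝ} (hs : 0 ≤ s) (hst : s ≤ t) :
    Btw (r.1 0) (r.1 s) (r.1 t) := by
  unfold Btw
  rw [r.dist_source hs, r.dist_source (hs.trans hst), r.2 s t hs (hs.trans hst),
    abs_of_nonpos (by linarith)]
  ring

theorem Ray.endpoint_eq_iff {r c : Ray X} :
    r.endpoint = c.endpoint ↔ ∃ d : ℝ, ∀ t : ℝ, 0 ≤ t → dist (r.1 t) (c.1 t) ≤ d :=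
  Quotient.eq (r := asymptoticSetoid X)

/-- If the geodesics from `x` to the points `y j` pass uniformly close to all earlier points of the
sequence `y`, which is unbounded, then they converge to a ray. -/
theorem exists_ray_of_near [CompleteSpace X] [CAT0Space X] {x : X} {ρ : ℝ} {y : ℕ → X}
    (hy : Tendsto (fun i => dist x (y i)) atTop atTop)
    (h : ∀ i j, i ≤ j → ∃ w, Btw x w (y j) ∧ dist w (y i) ≤ ρ) :
    ∃ r : Ray X, r.1 0 = x ∧ ∀ i p, Btw x p (y i) → dist x p + ρ ≤ dist x (y i) →
      dist p (r.1 (dist x p)) * dist x (y i) ≤ 2 * dist x p * ρ := by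
  choose c l hc using fun i => CAT0Space.exists_geodesic x (y i)
  obtain rfl : l = fun i => dist x (y i) := funext fun i => (hc i).length
  have hρ : 0 ≤ ρ := by
    obtain ⟨w, -, hw⟩ := h 0 0 le_rfl
    exact dist_nonneg.trans hw
  -- Up to distance `dist x p`, the geodesic to `y j` agrees with the geodesic to `w`, whose
  -- endpoint is within `ρ` of `y i`.
  have step : ∀ i j, i ≤ j → ∀ p, Btw x p (y i) → dist x p + ρ ≤ dist x (y i) →
      dist p (c j (dist x p)) * dist x (y i) ≤ 2 * dist x p * ρ := by
    intro i j hij p hp hpi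
    obtain ⟨w, hw, hwi⟩ := h i j hij
    have hpw : dist x p ≤ dist x w := by linarith [dist_triangle x w (y i)]
    obtain ⟨q, hq, hqw⟩ := exists_btw x w dist_nonneg hpw
    have hmem : dist x p ∈ Set.Icc 0 (dist x (y j)) := ⟨dist_nonneg, hpw.trans hw.le⟩
    obtain rfl : q = c j (dist x p) :=
      (hqw.trans_left hw).unique ((hc j).btw hmem) (by rw [hq, (hc j).dist_source hmem])
    refine (hp.dist_mul_le hqw hq.symm).trans ?_
    rw [dist_comm (y i)]
    gcongr
  have hlim : ∀ t : ℝ, ∃ z, 0 ≤ t → Tendsto (fun j => c j t) atTop (𝓝 z) := by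
    intro t
    by_cases ht : 0 ≤ t
    swap
    · exact ⟨x, fun h => absurd h ht⟩
    suffices CauchySeq fun j => c j t by
      obtain ⟨z, hz⟩ := cauchySeq_tendsto_of_complete this
      exact ⟨z, fun _ => hz⟩
    rw [Metric.cauchySeq_iff']
    intro ε hε
    obtain ⟨N, hN1, hN2⟩ := ((hy.eventually_ge_atTop (t + ρ)).and
      (hy.eventually_gt_atTop (2 * t * ρ / ε))).exists
    refine ⟨N, fun n hn => ?_⟩
    have hmem : t ∈ Set.Icc 0 (dist x (y N)) := ⟨ht, by linarith⟩
    have hd := (hc N).dist_source hmem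
    have := step N n hn (c N t) ((hc N).btw hmem) (by rwa [hd])
    rw [hd] at this
    rw [div_lt_iff₀ hε] at hN2
    have hpos : 0 < dist x (y N) := by
      by_contra hcon
      have h0 : dist x (y N) = 0 := le_antisymm (not_lt.1 hcon) dist_nonneg
      rw [h0, zero_mul] at hN2
      have : 0 ≤ 2 * t * ρ := by positivity
      linarith
    rw [dist_comm]
    by_contra hcon
    push Not at hcon
    nlinarith
  choose r hr using hlim
  refine ⟨⟨r, fun s t hs ht => ?_⟩, ?_, ?_⟩
  · refine tendsto_nhds_unique ((hr s hs).dist (hr t ht)) (tendsto_const_nhds.congr' ?_)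
    filter_upwards [hy.eventually_ge_atTop s, hy.eventually_ge_atTop t] with j hj1 hj2
    exact ((hc j).isom s ⟨hs, hj1⟩ t ⟨ht, hj2⟩).symm
  · refine tendsto_nhds_unique (hr 0 le_rfl) ?_
    simp only [(hc _).source]
    exact tendsto_const_nhds
  · intro i p hp hpi
    refine le_of_tendsto ((tendsto_const_nhds.dist (hr _ dist_nonneg)).mul_const _) ?_
    filter_upwards [eventually_ge_atTop i] with j hj
    exact step i j hj p hp hpi

/-- From every point there is a ray asymptotic to a given ray. -/
theorem Ray.exists_asymptotic [CompleteSpace X] [CAT0Space X] (r : Ray X) (x : X) :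
    ∃ c : Ray X, c.1 0 = x ∧ c.endpoint = r.endpoint ∧
      ∀ t : ℝ, 0 ≤ t → dist (r.1 t) (c.1 t) ≤ 3 * dist (r.1 0) x + 1 := by
  set D := dist (r.1 0) x with hD
  have hD0 : 0 ≤ D := dist_nonneg
  have hdist : ∀ t : ℝ, 0 ≤ t → |dist x (r.1 t) - t| ≤ D := by
    intro t ht
    have h1 := r.dist_source ht
    rw [abs_le]
    constructor <;>
      linarith [dist_triangle x (r.1 0) (r.1 t), dist_triangle (r.1 0) x (r.1 t),
        dist_comm x (r.1 0)]
  have near : ∀ s t : ℝ, 0 ≤ s → s ≤ t → ∃ w, Btw x w (r.1 t) ∧ dist w (r.1 s) ≤ D := by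
    intro s t hs hst
    obtain ⟨w, hw, hw'⟩ := (r.btw hs hst).symm.exists_near x
    exact ⟨w, hw.symm, by rwa [dist_comm]⟩
  have hy : Tendsto (fun i : ℕ => dist x (r.1 i)) atTop atTop := by
    refine tendsto_atTop_mono (fun i => ?_)
      (tendsto_atTop_add_const_right atTop (-D) tendsto_natCast_atTop_atTop)
    linarith [(abs_le.1 (hdist i i.cast_nonneg)).1]
  obtain ⟨c, hc0, hc⟩ := exists_ray_of_near (y := fun i : ℕ => r.1 i) hy fun i j hij =>
    near i j i.cast_nonneg (by exact_mod_cast hij)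
  have key : ∀ t : ℝ, 0 ≤ t → dist (r.1 t) (c.1 t) ≤ 3 * D + 1 := by
    intro t ht
    obtain ⟨i, hi1, hi2⟩ := ((hy.eventually_ge_atTop (t + D)).and
      ((hy.eventually_ge_atTop (2 * t * D + 1)).and
        (tendsto_natCast_atTop_atTop.eventually_ge_atTop t))).exists
    obtain ⟨q, hq, hqr⟩ := near t i ht hi2.2
    -- Sliding `q` along the geodesic to distance exactly `t` costs `2 * D`. With `D` from `r.1 t`
    -- to `q` and `1` from `p` to the limit ray, this makes `3 * D + 1`.
    obtain ⟨p, hp, hpq⟩ : ∃ p, (dist x p = t ∧ Btw x p (r.1 i)) ∧ dist p q ≤ 2 * D := by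
      have hqt : |dist x q - t| ≤ 2 * D := by
        have := abs_le.1 (hdist t ht)
        rw [abs_le]
        constructor <;>
          linarith [dist_triangle x q (r.1 t), dist_triangle x (r.1 t) q, dist_comm q (r.1 t)]
      have := abs_le.1 hqt
      rcases le_total t (dist x q) with hle | hle
      · obtain ⟨p, hp, hp'⟩ := exists_btw x q ht hle
        refine ⟨p, ⟨hp, hp'.trans_left hq⟩, ?_⟩
        unfold Btw at hp'
        linarith
      · have hq2 := hq
        unfold Btw at hq2
        obtain ⟨p, hp, hp'⟩ := exists_btw q (r.1 i) (t := t - dist x q) (by linarith)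
          (by linarith)
        have h3 := hq.trans_right hp'
        refine ⟨p, ⟨?_, h3⟩, ?_⟩
        · unfold Btw at *
          linarith
        · rw [dist_comm]
          linarith
    have hpc := hc i p hp.2 (by rw [hp.1]; exact hi1)
    rw [hp.1] at hpc
    have h1 : dist p (c.1 t) ≤ 1 := by
      by_contra hcon
      push Not at hcon
      have : 0 ≤ 2 * t * D := by positivity
      nlinarith [hi2.1]
    linarith [dist_triangle4 (r.1 t) q p (c.1 t), dist_comm q (r.1 t), dist_comm p q]
  exact ⟨c, hc0, (Ray.endpoint_eq_iff.2 ⟨_, key⟩).symm, key⟩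

theorem exists_ray [CompleteSpace X] [CAT0Space X] (x : X) (ξ : Boundary X) :
    ∃ r : Ray X, r.1 0 = x ∧ r.endpoint = ξ := by
  induction ξ using Quotient.inductionOn with
  | _ r =>
    obtain ⟨c, h0, h1, -⟩ := r.exists_asymptotic x
    exact ⟨c, h0, h1⟩

/-! ### Shadows and the cone topology -/

theorem mem_geod_of_btw [CAT0Space X] {x p w : X} {z : Bordification X} (hp : Btw x p w)
    (hw : w ∈ geod (.point x) z) : p ∈ geod (.point x) z := by
  cases z with
  | point y => exact mem_seg_iff.2 (hp.trans_left (mem_seg_iff.1 hw))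
  | ideal ξ =>
    obtain ⟨r, rfl, h, t, ht, rfl⟩ := hw
    refine ⟨r, rfl, h, dist (r.1 0) p, dist_nonneg, ?_⟩
    have hle := hp.le
    rw [r.dist_source ht] at hle
    exact (r.btw dist_nonneg hle).unique hp (r.dist_source dist_nonneg)

theorem exists_mem_geod_near [CompleteSpace X] [CAT0Space X] {x w : X} {z : Bordification X}
    (hw : w ∈ geod (.point x) z) (y : X) :
    ∃ w' ∈ geod (.point y) z, dist w w' ≤ 3 * dist x y + 1 := by
  cases z with
  | point a =>
    obtain ⟨w', h1, h2⟩ := (mem_seg_iff.1 hw).symm.exists_near y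
    exact ⟨w', mem_seg_iff.2 h1.symm, by linarith [dist_nonneg (x := x) (y := y)]⟩
  | ideal ξ =>
    obtain ⟨r, rfl, h, t, ht, rfl⟩ := hw
    obtain ⟨c, h1, h2, h3⟩ := r.exists_asymptotic y
    exact ⟨c.1 t, ⟨c, h1, h2.trans h, t, ht, rfl⟩, h3 t ht⟩

theorem exists_mem_geod_of_mem_basicNhd {r : Ray X} {t ε : ℝ} (ht : 0 ≤ t) {z : Bordification X}
    (hz : z ∈ basicNhd r t ε) :
    ∃ w ∈ geod (.point (r.1 0)) z, dist (r.1 0) w = t ∧ dist w (r.1 t) < ε := by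
  cases z with
  | point y =>
    obtain ⟨c, l, hc, h1, h2⟩ := hz
    exact ⟨c t, ⟨c, l, hc, t, ⟨ht, h1.le⟩, rfl⟩, hc.dist_source ⟨ht, h1.le⟩, h2⟩
  | ideal ξ =>
    obtain ⟨c, h0, h1, h2⟩ := hz
    exact ⟨c.1 t, ⟨c, h0, h1, t, ht, rfl⟩, by rw [← h0, c.dist_source ht], h2⟩

theorem mem_basicNhd_of_mem_geod [CAT0Space X] {r : Ray X} {ε : ℝ} {p w : X}
    {z : Bordification X} (hw : w ∈ geod (.point (r.1 0)) z) (hp : Btw (r.1 0) p w)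
    (hlt : dist (r.1 0) p < dist (r.1 0) w) (h : dist p (r.1 (dist (r.1 0) p)) < ε) :
    z ∈ basicNhd r (dist (r.1 0) p) ε := by
  cases z with
  | point y =>
    have hw' := mem_seg_iff.1 hw
    obtain ⟨c, hc, hcp⟩ := (hp.trans_left hw').exists_path
    exact ⟨c, _, hc, hlt.trans_le hw'.le, by rwa [hcp]⟩
  | ideal ξ =>
    obtain ⟨c, h0, h1, t, ht, rfl⟩ := hw
    rw [← h0] at hp
    have hle := hp.le
    rw [c.dist_source ht] at hle
    have hpc := (c.btw dist_nonneg hle).unique hp (c.dist_source dist_nonneg)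
    rw [h0] at hpc
    exact ⟨c, h0, h1, by rwa [hpc]⟩

/-- If the geodesic from `r 0` to `z` passes near a far away point of a ray `c`, then it passes
through the basic neighbourhoods that `c` passes through. -/
theorem mem_basicNhd_of_near [CAT0Space X] {r c : Ray X} (h0 : c.1 0 = r.1 0) {t ε S E η : ℝ}
    {w : X} {z : Bordification X} (hw : w ∈ geod (.point (r.1 0)) z) (hwc : dist w (c.1 S) ≤ E)
    (ht : 0 < t) (hS : t + E < S) (hSη : 2 * t * E < η * S) (h : dist (c.1 t) (r.1 t) + η ≤ ε) :
    z ∈ basicNhd r t ε := by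
  have hE : 0 ≤ E := dist_nonneg.trans hwc
  have hcS := c.dist_source (t := S) (by linarith)
  have hct := c.dist_source ht.le
  have hcb := c.btw (s := t) (t := S) ht.le (by linarith)
  rw [h0] at hcS hct hcb
  have htw : t < dist (r.1 0) w := by linarith [dist_triangle (r.1 0) w (c.1 S)]
  obtain ⟨p, hp, hpw⟩ := exists_btw (r.1 0) w ht.le htw.le
  -- The deviation at distance `t` is at most `2 * t * E / S`, which is below `η`.
  have key := hcb.dist_mul_le hpw (by rw [hp, hct])
  rw [hct, hcS, dist_comm (c.1 S)] at key
  have hlt : dist (c.1 t) p < η := by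
    by_contra hcon
    push Not at hcon
    nlinarith
  have := mem_basicNhd_of_mem_geod (ε := ε) hw hpw (by rwa [hp])
    (by rw [hp]; linarith [dist_triangle p (c.1 t) (r.1 t), dist_comm p (c.1 t)])
  rwa [hp] at this

theorem basicNhd_mem_nhds (r : Ray X) {t : ℝ} (ht : 0 < t) :
    basicNhd r t 1 ∈ 𝓝 (Bordification.ideal r.endpoint) :=
  (TopologicalSpace.isOpen_generateFrom_of_mem (Or.inr ⟨r, t, 1, ht, one_pos, rfl⟩)).mem_nhds
    ⟨r, rfl, rfl, by simp⟩

/-- The basic neighbourhoods along a single ray, from any basepoint, shrink to its endpoint in the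
cone topology. -/
theorem tendsto_basicNhd_smallSets [CompleteSpace X] [CAT0Space X] (r : Ray X) :
    Tendsto (fun T => basicNhd r T 1) atTop (𝓝 (Bordification.ideal r.endpoint)).smallSets := by
  -- The neighbourhood filter is an infimum over generators containing the point, so each generator
  -- can be treated separately.
  rw [TopologicalSpace.nhds_generateFrom, smallSets_iInf, tendsto_iInf]
  intro s
  by_cases hs : s ∈ {s | Bordification.ideal r.endpoint ∈ s ∧ s ∈
    ({S | ∃ O : Set X, IsOpen O ∧ S = Bordification.point '' O} ∪
      {S | ∃ (r : Ray X) (t ε : ℝ), 0 < t ∧ 0 < ε ∧ S = basicNhd r t ε})}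
  swap
  · simp only [iInf_neg hs, smallSets_top]
    exact tendsto_top
  simp only [iInf_pos hs, smallSets_principal, tendsto_principal]
  obtain ⟨hmem, ⟨O, -, rfl⟩ | ⟨r', t, ε, ht, hε, rfl⟩⟩ := hs
  · simp at hmem
  obtain ⟨c, hc0, hc1, hc⟩ := hmem
  obtain ⟨K, hK⟩ := Ray.endpoint_eq_iff.1 hc1
  -- Change of basepoint, width of the neighbourhood, and distance between the asymptotic rays
  -- `r'`-side `c` and `r`.
  set E := (3 * dist (r.1 0) (r'.1 0) + 1) + 1 + K with hE
  filter_upwards [eventually_gt_atTop (t + E), eventually_ge_atTop (0 : ℝ),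
    eventually_gt_atTop (2 * t * E / (ε - dist (c.1 t) (r'.1 t)))] with T h1 h2 h3 z hz
  obtain ⟨w, hw, -, hwr⟩ := exists_mem_geod_of_mem_basicNhd h2 hz
  obtain ⟨w', hw', hww'⟩ := exists_mem_geod_near hw (r'.1 0)
  refine mem_basicNhd_of_near hc0 hw' (S := T) (E := E) (η := ε - dist (c.1 t) (r'.1 t)) ?_ ht h1
    ?_ (by linarith)
  · have := hK T h2
    linarith [dist_triangle4 w' w (r.1 T) (c.1 T), dist_comm w' w, dist_comm (c.1 T) (r.1 T)]
  · rwa [div_lt_iff₀ (by linarith), mul_comm T] at h3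

theorem exists_basicNhd_subset [CompleteSpace X] [CAT0Space X] (r : Ray X)
    {U : Set (Bordification X)} (hU : U ∈ 𝓝 (Bordification.ideal r.endpoint)) :
    ∃ T, 0 < T ∧ basicNhd r T 1 ⊆ U :=
  ((eventually_gt_atTop 0).and
    (tendsto_smallSets_iff.1 (tendsto_basicNhd_smallSets r) U hU)).exists

/-- If `y n` converges to `ξ`, then the shadow of the `E`-ball about `y n`, seen from `x`, is
eventually contained in any given neighbourhood of `ξ`. -/
theorem eventually_shadow_subset [CompleteSpace X] [CAT0Space X] {ξ : Boundary X} {y : ℕ → X}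
    (hy : Tendsto (fun n => Bordification.point (y n)) atTop (𝓝 (Bordification.ideal ξ)))
    (x : X) (E : ℝ) {U : Set (Bordification X)} (hU : U ∈ 𝓝 (Bordification.ideal ξ)) :
    ∀ᶠ n in atTop, ∀ z, ∀ w ∈ geod (.point x) z, dist w (y n) ≤ E → z ∈ U := by
  obtain ⟨r, rfl, rfl⟩ := exists_ray x ξ
  obtain ⟨T, hT, hTU⟩ := exists_basicNhd_subset r hU
  obtain ⟨S, hS0, hS1, hS2⟩ := ((eventually_gt_atTop (0 : ℝ)).and
    ((eventually_gt_atTop (T + (E + 1))).and (eventually_gt_atTop (2 * T * (E + 1))))).exists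
  filter_upwards [hy.eventually_mem (basicNhd_mem_nhds r hS0)] with n hn z w hw hwn
  obtain ⟨v, hv, -, hvr⟩ := exists_mem_geod_of_mem_basicNhd hS0.le hn
  obtain ⟨v', hv', hvv'⟩ := (mem_seg_iff.1 hv).exists_near w
  refine hTU (mem_basicNhd_of_near (c := r) rfl (mem_geod_of_btw hv' hw) (S := S) (E := E + 1)
    (η := 1) ?_ hT hS1 (by linarith) (by simp))
  linarith [dist_triangle v' v (r.1 S), dist_comm v v', dist_comm w (y n)]

/-- Each `z n` lies on the geodesic ending at it, hence in the shadow of the `D`-ball about `y n`.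
-/
theorem tendsto_of_dist_le [CompleteSpace X] [CAT0Space X] {ξ : Boundary X} {y z : ℕ → X}
    (hy : Tendsto (fun n => Bordification.point (y n)) atTop (𝓝 (Bordification.ideal ξ)))
    {D : ℝ} (h : ∀ n, dist (z n) (y n) ≤ D) :
    Tendsto (fun n => Bordification.point (z n)) atTop (𝓝 (Bordification.ideal ξ)) := by
  refine fun U hU => mem_map.2 ?_
  filter_upwards [eventually_shadow_subset hy (y 0) D hU] with n hn
  exact hn _ (z n) (mem_seg_iff.2 (by simp [Btw])) (h n)

/-- A basic neighbourhood with parameter `t` based at `x` contains only points of `X` farther than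
`t` from `x`. -/
theorem tendsto_dist_atTop [CompleteSpace X] [CAT0Space X] {ξ : Boundary X} {y : ℕ → X}
    (hy : Tendsto (fun n => Bordification.point (y n)) atTop (𝓝 (Bordification.ideal ξ)))
    (x : X) : Tendsto (fun n => dist x (y n)) atTop atTop := by
  obtain ⟨r, rfl, rfl⟩ := exists_ray x ξ
  rw [tendsto_atTop]
  intro b
  have hpos : 0 < max b 1 := by positivity
  filter_upwards [hy.eventually_mem (basicNhd_mem_nhds r hpos)] with n hn
  obtain ⟨w, hw, hd, -⟩ := exists_mem_geod_of_mem_basicNhd hpos.le hn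
  linarith [le_max_left b 1, (mem_seg_iff.1 hw).le]

/-- A sequence of points far away from `x` such that the geodesics from `x` to its points pass
uniformly close to all earlier points converges to a boundary point. -/
theorem exists_tendsto_of_near [CompleteSpace X] [CAT0Space X] {x : X} {ρ : ℝ} {y : ℕ → X}
    (hy : Tendsto (fun i => dist x (y i)) atTop atTop)
    (h : ∀ i j, i ≤ j → ∃ w, Btw x w (y j) ∧ dist w (y i) ≤ ρ) :
    ∃ r : Ray X, r.1 0 = x ∧
      Tendsto (fun n => Bordification.point (y n)) atTop (𝓝 (Bordification.ideal r.endpoint)) ∧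
      ∀ B : ℝ, ∀ᶠ i in atTop, ∀ p, Btw x p (y i) → dist x p ≤ B →
        dist p (r.1 (dist x p)) < 1 := by
  obtain ⟨r, rfl, hr⟩ := exists_ray_of_near hy h
  have hρ : 0 ≤ ρ := by
    obtain ⟨w, -, hw⟩ := h 0 0 le_rfl
    exact dist_nonneg.trans hw
  -- Besides giving convergence, this uniform closeness later locates the limit point of an orbit in
  -- `U`.
  have close : ∀ B : ℝ, ∀ᶠ i in atTop, ∀ p, Btw (r.1 0) p (y i) → dist (r.1 0) p ≤ B →
      dist p (r.1 (dist (r.1 0) p)) < 1 := by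
    intro B
    filter_upwards [hy.eventually_ge_atTop (B + ρ), hy.eventually_gt_atTop (2 * B * ρ)]
      with i h1 h2 p hp hpB
    have := hr i p hp (by linarith)
    by_contra hcon
    push Not at hcon
    have hmul := mul_le_mul_of_nonneg_right hpB hρ
    nlinarith [dist_nonneg (x := r.1 0) (y := y i)]
  refine ⟨r, rfl, fun U hU => mem_map.2 ?_, close⟩
  obtain ⟨T, hT, hTU⟩ := exists_basicNhd_subset r hU
  filter_upwards [close T, hy.eventually_gt_atTop T] with i h1 h2
  obtain ⟨p, hp, hpb⟩ := exists_btw (r.1 0) (y i) hT.le h2.le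
  have := mem_basicNhd_of_mem_geod (z := .point (y i)) (w := y i)
    (mem_seg_iff.2 (by simp [Btw])) hpb (by rwa [hp]) (h1 p hpb hp.le)
  rw [hp] at this
  exact hTU this

/-! ### Ping-pong -/

theorem Btw.map {x p y : X} (h : Btw x p y) (e : X ≃ᵢ X) : Btw (e x) (e p) (e y) := by
  unfold Btw at *
  rwa [e.dist_eq, e.dist_eq, e.dist_eq]

theorem Btw.refl_right (x y : X) : Btw x y y := by simp [Btw]

/-- Ping-pong data for the isometry `F * G⁻¹`: geodesics between `U` and `V`, and between `U'` and
`V'`, pass near the basepoint `x`, and the shadows of balls about the images of `x` under `F`, `G`,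
`F⁻¹`, `G⁻¹` lie in `U`, `V`, `U'`, `V'`. -/
structure PingPong (F G : X ≃ᵢ X) (x : X) (ρ : ℝ) (U V U' V' : Set (Bordification X)) : Prop where
  near : ∀ u v, .point u ∈ U → .point v ∈ V → ∃ p, Btw u p v ∧ dist p x ≤ ρ
  near' : ∀ u v, .point u ∈ U' → .point v ∈ V' → ∃ p, Btw u p v ∧ dist p x ≤ ρ
  shadow_f : ∀ z, ∀ w ∈ geod (.point x) z, dist w (F x) ≤ ρ + 1 → z ∈ U
  shadow_g : ∀ z, ∀ w ∈ geod (.point x) z, dist w (G x) ≤ ρ + 1 → z ∈ V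
  shadow_f' : ∀ z, ∀ w ∈ geod (.point x) z, dist w (F⁻¹ x) ≤ ρ + 1 → z ∈ U'
  shadow_g' : ∀ z, ∀ w ∈ geod (.point x) z, dist w (G⁻¹ x) ≤ ρ + 1 → z ∈ V'
  far_f : 2 * ρ + 1 ≤ dist x (F x)
  far_g : 2 * ρ + 1 ≤ dist x (G x)
  nonneg : 0 ≤ ρ

namespace PingPong

variable {F G : X ≃ᵢ X} {x : X} {ρ : ℝ} {U V U' V' : Set (Bordification X)}

theorem symm (H : PingPong F G x ρ U V U' V') : PingPong G F x ρ V U V' U' where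
  near u v hu hv := by
    obtain ⟨p, hp, hpx⟩ := H.near v u hv hu
    exact ⟨p, hp.symm, hpx⟩
  near' u v hu hv := by
    obtain ⟨p, hp, hpx⟩ := H.near' v u hv hu
    exact ⟨p, hp.symm, hpx⟩
  shadow_f := H.shadow_g
  shadow_g := H.shadow_f
  shadow_f' := H.shadow_g'
  shadow_g' := H.shadow_f'
  far_f := H.far_g
  far_g := H.far_f
  nonneg := H.nonneg

theorem pow_succ_apply (j : ℕ) : ((F * G⁻¹) ^ (j + 1)) x = F (G⁻¹ (((F * G⁻¹) ^ j) x)) := by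
  rw [pow_succ', IsometryEquiv.mul_apply, IsometryEquiv.mul_apply]

variable [CAT0Space X]

/-- The geodesic from `F⁻¹ x`, which is in `U'`, to `G⁻¹ y` passes near `x`; apply `F`. -/
theorem exists_near_f (H : PingPong F G x ρ U V U' V') {y : X} (hy : .point (G⁻¹ y) ∈ V') :
    ∃ w, Btw x w (F (G⁻¹ y)) ∧ dist w (F x) ≤ ρ := by
  obtain ⟨p, hp, hpx⟩ := H.near' (F⁻¹ x) (G⁻¹ y)
    (H.shadow_f' _ (F⁻¹ x) (mem_seg_iff.2 (Btw.refl_right _ _))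
      (by rw [dist_self]; linarith [H.nonneg])) hy
  refine ⟨F p, ?_, by rwa [F.dist_eq]⟩
  simpa using hp.map F

/-- The geodesic from `y` to `G x`, which is in `V`, passes near `x`; apply `G⁻¹`. -/
theorem exists_near_g (H : PingPong F G x ρ U V U' V') {y : X} (hy : .point y ∈ U) :
    ∃ w, Btw x w (G⁻¹ y) ∧ dist w (G⁻¹ x) ≤ ρ := by
  obtain ⟨p, hp, hpx⟩ := H.near y (G x) hy
    (H.shadow_g _ (G x) (mem_seg_iff.2 (Btw.refl_right _ _))
      (by rw [dist_self]; linarith [H.nonneg]))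
  refine ⟨G⁻¹ p, ?_, by rwa [(G⁻¹).dist_eq]⟩
  simpa using (hp.map G⁻¹).symm

theorem point_mem_of_near_f (H : PingPong F G x ρ U V U' V') {y : X}
    (hy : ∃ w, Btw x w y ∧ dist w (F x) ≤ ρ) : .point y ∈ U := by
  obtain ⟨w, hw, hwx⟩ := hy
  exact H.shadow_f _ w (mem_seg_iff.2 hw) (by linarith)

/-- One turn of the game: `F` takes `V'` to `U`, then `G⁻¹` takes `U` back to `V'`. -/
theorem inv_pow_mem (H : PingPong F G x ρ U V U' V') (j : ℕ) :
    .point (G⁻¹ (((F * G⁻¹) ^ j) x)) ∈ V' := by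
  have self_mem : .point (G⁻¹ x) ∈ V' :=
    H.shadow_g' _ (G⁻¹ x) (mem_seg_iff.2 (Btw.refl_right _ _))
      (by rw [dist_self]; linarith [H.nonneg])
  induction j with
  | zero => simpa using self_mem
  | succ j ih =>
    obtain ⟨w, hw, hwx⟩ := H.exists_near_g (H.point_mem_of_near_f (H.exists_near_f ih))
    rw [pow_succ_apply]
    exact H.shadow_g' _ w (mem_seg_iff.2 hw) (by linarith)

theorem exists_near_pow (H : PingPong F G x ρ U V U' V') (j : ℕ) :
    ∃ w, Btw x w (((F * G⁻¹) ^ (j + 1)) x) ∧ dist w (F x) ≤ ρ := by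
  rw [pow_succ_apply]
  exact H.exists_near_f (H.inv_pow_mem j)

theorem pow_mem (H : PingPong F G x ρ U V U' V') (j : ℕ) :
    .point (((F * G⁻¹) ^ (j + 1)) x) ∈ U :=
  H.point_mem_of_near_f (H.exists_near_pow j)

/-- Passing within `ρ` of `F x` forces `dist x (F z) ≥ dist x (F x) + dist x z - 2 * ρ`, a gain of
at least `1` by `far_f`; similarly for `G⁻¹`. -/
theorem le_dist_pow_succ (H : PingPong F G x ρ U V U' V') (j : ℕ) :
    (j : ℝ) ≤ dist x (((F * G⁻¹) ^ (j + 1)) x) := by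
  induction j with
  | zero => simp
  | succ j ih =>
    obtain ⟨w, hw, hwx⟩ := H.exists_near_pow (j + 1)
    obtain ⟨v, hv, hvx⟩ := H.exists_near_g (H.pow_mem j)
    rw [pow_succ_apply (j + 1)] at hw ⊢
    set y := ((F * G⁻¹) ^ (j + 1)) x
    have h1 : dist (F x) (F (G⁻¹ y)) = dist x (G⁻¹ y) := F.dist_eq _ _
    have h2 : dist (G⁻¹ x) (G⁻¹ y) = dist x y := (G⁻¹).dist_eq _ _
    have h3 : dist x (G⁻¹ x) = dist x (G x) := by
      rw [← G.dist_eq, IsometryEquiv.apply_inv_self, dist_comm]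
    unfold Btw at hw hv
    push_cast
    linarith [dist_triangle x w (F x), dist_triangle (F x) w (F (G⁻¹ y)), dist_comm w (F x),
      dist_triangle x v (G⁻¹ x), dist_triangle (G⁻¹ x) v (G⁻¹ y), dist_comm v (G⁻¹ x),
      H.far_f, H.far_g, H.nonneg]

/-- The orbit of `x` escapes at speed at least `1`, while a point displaced by `a` has an orbit of
speed at most `a`. Orbits of different points stay at bounded distance, so `a ≥ 1`. -/
theorem translationLength_pos (H : PingPong F G x ρ U V U' V') :
    0 < translationLength (F * G⁻¹) := by
  have : Nonempty X := ⟨x⟩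
  refine one_pos.trans_le (le_ciInf fun y => ?_)
  set h := F * G⁻¹
  set a := dist y (h y)
  have hpow : ∀ m : ℕ, dist y ((h ^ m) y) ≤ m * a := by
    intro m
    induction m with
    | zero => simp
    | succ m ih =>
      have := dist_triangle y (h y) ((h ^ (m + 1)) y)
      rw [pow_succ', IsometryEquiv.mul_apply, h.dist_eq] at this
      rw [pow_succ', IsometryEquiv.mul_apply]
      push_cast
      linarith
  by_contra hcon
  push Not at hcon
  obtain ⟨m, hm⟩ := exists_nat_gt ((2 * dist x y + a) / (1 - a))
  rw [div_lt_iff₀ (by linarith)] at hm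
  have h1 := H.le_dist_pow_succ m
  have h2 := hpow (m + 1)
  have h3 : dist ((h ^ (m + 1)) y) ((h ^ (m + 1)) x) = dist y x := (h ^ (m + 1)).dist_eq _ _
  push_cast at h2
  linarith [dist_triangle4 x y ((h ^ (m + 1)) y) ((h ^ (m + 1)) x), dist_comm x y]

theorem exists_near_of_le (H : PingPong F G x ρ U V U' V') (i j : ℕ) (hij : i ≤ j) :
    ∃ w, Btw x w (((F * G⁻¹) ^ j) x) ∧ dist w (((F * G⁻¹) ^ i) x) ≤ ρ := by
  obtain ⟨k, rfl⟩ := Nat.exists_eq_add_of_le hij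
  rcases i with _ | i
  · exact ⟨x, by simp [Btw], by simpa using H.nonneg⟩
  rcases k with _ | k
  · exact ⟨_, Btw.refl_right _ _, by simpa using H.nonneg⟩
  -- By symmetry, the backward orbit, which is the forward orbit of `G * F⁻¹`, lies in `V`.
  obtain ⟨p, hp, hpx⟩ := H.near _ _ (H.pow_mem k) (H.symm.pow_mem i)
  refine ⟨((F * G⁻¹) ^ (i + 1)) p, ?_, by rwa [IsometryEquiv.dist_eq]⟩
  have := (hp.map ((F * G⁻¹) ^ (i + 1))).symm
  rw [← IsometryEquiv.mul_apply, ← IsometryEquiv.mul_apply, ← pow_add,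
    show G * F⁻¹ = (F * G⁻¹)⁻¹ by group, inv_pow, mul_inv_cancel] at this
  exact this

theorem exists_isPosLimit [CompleteSpace X] (H : PingPong F G x ρ U V U' V') :
    ∃ ξ, IsPosLimit (F * G⁻¹) ξ ∧ .ideal ξ ∈ U := by
  have hy : Tendsto (fun i => dist x (((F * G⁻¹) ^ i) x)) atTop atTop := by
    rw [← tendsto_add_atTop_iff_nat 1]
    exact tendsto_atTop_mono H.le_dist_pow_succ tendsto_natCast_atTop_atTop
  obtain ⟨r, hr0, hr, hclose⟩ := exists_tendsto_of_near hy H.exists_near_of_le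
  refine ⟨r.endpoint, ⟨x, hr⟩, ?_⟩
  obtain ⟨j, hj⟩ := ((tendsto_add_atTop_nat 1).eventually
    (hclose (dist x (F x) + ρ))).exists
  obtain ⟨w, hw, hwx⟩ := H.exists_near_pow j
  have hlt := hj w hw (by linarith [dist_triangle x (F x) w, dist_comm w (F x)])
  -- The limit ray passes within `1` of `w`, and `w` is within `ρ` of `F x`: hence the radius `ρ +
  -- 1` of the shadows.
  refine H.shadow_f _ (r.1 (dist x w)) ⟨r, hr0, rfl, _, dist_nonneg, rfl⟩ ?_
  linarith [dist_triangle (r.1 (dist x w)) w (F x), dist_comm w (r.1 (dist x w))]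

end PingPong

/-! ### Limit points and farness -/

theorem IsPosLimit.tendsto [CompleteSpace X] [CAT0Space X] {f : X ≃ᵢ X} {ξ : Boundary X}
    (h : IsPosLimit f ξ) (x : X) :
    Tendsto (fun n : ℕ => Bordification.point ((f ^ n) x)) atTop (𝓝 (.ideal ξ)) := by
  obtain ⟨y, hy⟩ := h
  exact tendsto_of_dist_le hy (D := dist x y) fun n => ((f ^ n).dist_eq x y).le

theorem IsNegLimit.isPosLimit {f : X ≃ᵢ X} {ξ : Boundary X} (h : IsNegLimit f ξ) :
    IsPosLimit f⁻¹ ξ := by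
  obtain ⟨x, hx⟩ := h
  exact ⟨x, by simpa using hx⟩

theorem IsPosLimit.isNegLimit {f : X ≃ᵢ X} {ξ : Boundary X} (h : IsPosLimit f⁻¹ ξ) :
    IsNegLimit f ξ := by
  obtain ⟨x, hx⟩ := h
  exact ⟨x, by simpa using hx⟩

/-- Far boundary points have neighbourhoods such that all geodesics between points of them pass
near a given point `x`, and all pairs of boundary points in them are far. -/
theorem IsFar.exists_nhds [CAT0Space X] {ξ η : Boundary X} (h : IsFar ξ η) (x : X) :
    ∃ U ∈ 𝓝 (Bordification.ideal ξ), ∃ V ∈ 𝓝 (Bordification.ideal η),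
      (∃ ρ : ℝ, ∀ u v, .point u ∈ U → .point v ∈ V → ∃ p, Btw u p v ∧ dist p x ≤ ρ) ∧
      ∀ ξ' η', .ideal ξ' ∈ U → .ideal η' ∈ V → IsFar ξ' η' := by
  obtain ⟨ε, R, hε, hR, U, hU, V, hV, o, ρ, H⟩ := h
  -- On interiors, the same `U`, `V` and ball witness farness for every pair of boundary points.
  refine ⟨interior U, interior_mem_nhds.2 hU, interior V, interior_mem_nhds.2 hV,
    ⟨ρ + dist o x, fun u v hu hv => ?_⟩, fun ξ' η' hξ' hη' => ⟨ε, R, hε, hR, U,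
      mem_interior_iff_mem_nhds.1 hξ', V, mem_interior_iff_mem_nhds.1 hη', o, ρ, H⟩⟩
  obtain ⟨p, ⟨hp, hpo⟩, -⟩ := H _ (interior_subset hu) _ (interior_subset hv) (Or.inl ⟨u, rfl⟩)
  exact ⟨p, mem_seg_iff.1 hp, by linarith [dist_triangle p o x, Metric.mem_closedBall.1 hpo]⟩

end CATZero

end

theorem mainTheorem5 {X : Type*} [MetricSpace X] [CompleteSpace X] [CAT0Space X]
    (f g : X ≃ᵢ X) (ξfp ξfn ξgp ξgn : Boundary X)
    (hfp : IsPosLimit f ξfp) (hfn : IsNegLimit f ξfn)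
    (hgp : IsPosLimit g ξgp) (hgn : IsNegLimit g ξgn)
    (hpos : IsFar ξfp ξgp) (hneg : IsFar ξfn ξgn)
    (U₀ V₀ : Set (Bordification X))
    (hU₀ : U₀ ∈ 𝓝 (Bordification.ideal ξfp)) (hV₀ : V₀ ∈ 𝓝 (Bordification.ideal ξgp)) :
    ∀ᶠ n : ℕ in atTop,
      IsVile (f ^ n * g ^ (-(n : ℤ))) ∨
        (0 < translationLength (f ^ n * g ^ (-(n : ℤ))) ∧
          ∃ ξ η : Boundary X,
            IsPosLimit (f ^ n * g ^ (-(n : ℤ))) ξ ∧ IsNegLimit (f ^ n * g ^ (-(n : ℤ))) η ∧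
              IsFar ξ η ∧ Bordification.ideal ξ ∈ U₀ ∧ Bordification.ideal η ∈ V₀) := by
  obtain ⟨x, -⟩ := id hfp
  replace hfp := hfp.tendsto x
  replace hfn := hfn.isPosLimit.tendsto x
  replace hgp := hgp.tendsto x
  replace hgn := hgn.isPosLimit.tendsto x
  obtain ⟨U, hU, V, hV, ⟨ρ₁, h₁⟩, hfar⟩ := hpos.exists_nhds x
  obtain ⟨U', hU', V', hV', ⟨ρ₂, h₂⟩, -⟩ := hneg.exists_nhds x
  set ρ := max (max ρ₁ ρ₂) 0
  have hρ₁ : ρ₁ ≤ ρ := (le_max_left _ _).trans (le_max_left _ _)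
  have hρ₂ : ρ₂ ≤ ρ := (le_max_right _ _).trans (le_max_left _ _)
  filter_upwards [eventually_shadow_subset hfp x (ρ + 1) (inter_mem hU hU₀),
    eventually_shadow_subset hgp x (ρ + 1) (inter_mem hV hV₀),
    eventually_shadow_subset hfn x (ρ + 1) hU', eventually_shadow_subset hgn x (ρ + 1) hV',
    (tendsto_dist_atTop hfp x).eventually_ge_atTop (2 * ρ + 1),
    (tendsto_dist_atTop hgp x).eventually_ge_atTop (2 * ρ + 1)] with n s₁ s₂ s₃ s₄ d₁ d₂
  rw [zpow_neg, zpow_natCast]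
  have H : PingPong (f ^ n) (g ^ n) x ρ (U ∩ U₀) (V ∩ V₀) U' V' :=
    { near := fun u v hu hv => by
        obtain ⟨p, hp, hpx⟩ := h₁ u v hu.1 hv.1
        exact ⟨p, hp, hpx.trans hρ₁⟩
      near' := fun u v hu hv => by
        obtain ⟨p, hp, hpx⟩ := h₂ u v hu hv
        exact ⟨p, hp, hpx.trans hρ₂⟩
      shadow_f := s₁
      shadow_g := s₂
      shadow_f' := by rwa [← inv_pow]
      shadow_g' := by rwa [← inv_pow]
      far_f := d₁
      far_g := d₂
      nonneg := le_max_right _ _ }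
  obtain ⟨ξ, hξ, hξU⟩ := H.exists_isPosLimit
  obtain ⟨η, hη, hηV⟩ := H.symm.exists_isPosLimit
  -- Exchanging `f` and `g` inverts the isometry, so the positive limit point obtained is a negative
  -- one.
  rw [show g ^ n * (f ^ n)⁻¹ = (f ^ n * (g ^ n)⁻¹)⁻¹ by group] at hη
  exact Or.inr ⟨H.translationLength_pos, ξ, η, hξ, hη.isNegLimit,
    hfar ξ η hξU.1 hηV.1, hξU.2, hηV.2⟩
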